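/- Let $d\in\mathbb N$ and $0<\epsilon<d/2$. For $s\in[\epsilon,d-\epsilon]$, an integer $N\ge 0$ and a Borel probability measure $\mu$ on $\mathbb R^d$ put $$F_{N,s}(\mu)=\inf_{\gamma}\int_{(\mathbb R^d)^N}\sum_{1\le i\ne j\le N}|x_i-x_j|^{-s}\,d\gamma(x_1,\dots,x_N),\qquad E^{\mathrm{xc}}_{N,s}(\mu)=F_{N,s}(\mu)-N^2\iint|x-y|^{-s}\,d\mu(x)\,d\mu(y),$$ where $\gamma$ ranges over the Borel probability measures on $(\mathbb R^d)^N$ that are invariant under permutations of the $N$ coordinates and have all their $\mathbb R^d$-marginals equal to $\mu$, the sum is over ordered pairs, and $|x-y|^{-s}=+\infty$ if $x=y$; thus $F_{0,s}=F_{1,s}=0$. For real $N\ge 2$ put $$F_{\mathrm{GC},N,s}(\mu)=\inf\Big\{\sum_{n=2}^\infty\alpha_nF_{n,s}(\mu_n):\ \alpha_n\ge 0,\ \mu_n\text{ Borel probability measures on }\mathbb R^d,\ \sum_{n=0}^\infty\alpha_n=1,\ \sum_{n=1}^\infty n\alpha_n\mu_n=N\mu\Big\},$$ $$E^{\mathrm{xc}}_{\mathrm{GC},N,s}(\mu)=F_{\mathrm{GC},N,s}(\mu)-N^2\iint|x-y|^{-s}\,d\mu(x)\,d\mu(y).$$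 Then there is a constant $-\infty<c_{\mathrm{LO}}(d,\epsilon)<0$, depending only on $d$ and $\epsilon$, such that for every $s\in[\epsilon,d-\epsilon]$ and every Borel probability measure $\mu$ on $\mathbb R^d$ with a density $\rho\in L^{1+s/d}(\mathbb R^d)$, these energies are finite and $$c_{\mathrm{LO}}(d,\epsilon)\int_{\mathbb R^d}\rho^{1+\frac sd}(x)\,dx\ \le\ N^{-1-\frac sd}E^{\mathrm{xc}}_{N,s}(\mu)\ \le\ 0\quad\text{for all integers }N\ge 2,$$ $$c_{\mathrm{LO}}(d,\epsilon)\int_{\mathbb R^d}\rho^{1+\frac sd}(x)\,dx\ \le\ N^{-1-\frac sd}E^{\mathrm{xc}}_{\mathrm{GC},N,s}(\mu)\ \le\ 0\quad\text{for all real }N\ge 2.$$ -/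

import Mathlib

open MeasureTheory
open scoped ENNReal

namespace RieszOT

noncomputable section

variable {X : Type*} [MeasurableSpace X]

/-- The admissible plans: Borel probability measures on `X^N` that are invariant under all
permutations of the `N` coordinates and all of whose one-body marginals equal `μ`. -/
def symPlans (N : ℕ) (μ : Measure X) : Set (Measure (Fin N → X)) :=
  {γ | IsProbabilityMeasure γ ∧
    (∀ σ : Equiv.Perm (Fin N), γ.map (fun x i => x (σ i)) = γ) ∧
    ∀ i : Fin N, γ.map (fun x => x i) = μ}

/-- The `N`-marginal optimal transport cost: the infimum over admissible plans of the integral of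
`∑_{i ≠ j} c (x_i, x_j)` over ordered pairs. (For `N = 0, 1` the sum is empty and the value is
`0` for every probability measure.) -/
def otCost (c : X → X → ℝ≥0∞) (N : ℕ) (μ : Measure X) : ℝ≥0∞ :=
  ⨅ γ ∈ symPlans N μ,
    ∫⁻ x, ∑ p ∈ (Finset.univ : Finset (Fin N)).offDiag, c (x p.1) (x p.2) ∂γ

/-- The pairs of a weight sequence `α` and a sequence `ν` of probability measures with
`∑_{n ≥ 0} α_n = 1` and `∑_{n ≥ 1} n α_n ν_n = N μ`
(the `n = 0` term of the second sum is zero). -/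
def gcCompetitors (N : ℝ) (μ : Measure X) : Set ((ℕ → ℝ≥0∞) × (ℕ → Measure X)) :=
  {p | (∀ n, IsProbabilityMeasure (p.2 n)) ∧ ∑' n, p.1 n = 1 ∧
    Measure.sum (fun n : ℕ => ((n : ℝ≥0∞) * p.1 n) • p.2 n) = ENNReal.ofReal N • μ}

/-- The grand-canonical optimal transport cost: the infimum of `∑_{n ≥ 2} α_n F_n(ν_n)`. -/
def gcCost (c : X → X → ℝ≥0∞) (N : ℝ) (μ : Measure X) : ℝ≥0∞ :=
  ⨅ p ∈ gcCompetitors N μ, ∑' n : ℕ, p.1 (n + 2) * otCost c (n + 2) (p.2 (n + 2))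

/-- The mean-field energy `∬ c(x, y) dμ(x) dμ(y)`. -/
def meanField (c : X → X → ℝ≥0∞) (μ : Measure X) : ℝ≥0∞ :=
  ∫⁻ x, ∫⁻ y, c x y ∂μ ∂μ

/-- The exchange-correlation energy, as an extended real number.
It is `⊥` when the mean-field energy is infinite and `N ≠ 0`. -/
def exc (c : X → X → ℝ≥0∞) (N : ℕ) (μ : Measure X) : EReal :=
  (otCost c N μ : EReal) - (((N : ℝ≥0∞) ^ 2 * meanField c μ : ℝ≥0∞) : EReal)

/-- The grand-canonical exchange-correlation energy, as an extended real number. -/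
def gcExc (c : X → X → ℝ≥0∞) (N : ℝ) (μ : Measure X) : EReal :=
  (gcCost c N μ : EReal) - ((ENNReal.ofReal N ^ 2 * meanField c μ : ℝ≥0∞) : EReal)

/-- The cost `|x - y|^{-s}` on `ℝ^d` with the Euclidean distance; for `s > 0` it is `∞` at
`x = y`. -/
def rieszCost (d : ℕ) (s : ℝ) (x y : EuclideanSpace ℝ (Fin d)) : ℝ≥0∞ :=
  edist x y ^ (-s)

end

end RieszOT

/-! Up to a constant, `|x - y| ^ (-s)` is the measure of the set of balls containing both `x` and
`y`, where balls of radius `r` have weight `r ^ (-s - 1 - d)` (Fefferman and de la Llave). So it is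
enough to count pairs in each ball separately: if a ball holds `n` particles, with mean `m`, the
tangent inequality `n ^ 2 - n ≥ 2 m n - m ^ 2 - n` gives at least `m ^ 2 - m` ordered pairs on
average. Its right-hand side is affine in `n`, so mixtures of particle numbers are covered too.
The loss with respect to the mean-field value `m ^ 2` is therefore at most `min m (m ^ 2)` per ball.
Integrating over all balls, with `m` for the part of the density where `ρ > r ^ (-d)` and `m ^ 2`
for the rest, bounds the total loss by a multiple of `∫ ρ ^ (1 + s / d)`. For the upper bounds one
inserts independent particles, in Poisson number in the grand-canonical case. -/

namespace RieszOT

section MultiMarginal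

variable {X : Type*} [MeasurableSpace X]

theorem pi_mem_symPlans (N : ℕ) (μ : Measure X) [IsProbabilityMeasure μ] :
    Measure.pi (fun _ : Fin N => μ) ∈ symPlans N μ := by
  refine ⟨inferInstance, fun σ => ?_, fun i => (measurePreserving_eval _ i).map_eq⟩
  convert (measurePreserving_piCongrLeft (fun _ : Fin N => μ) σ.symm).map_eq using 2
  ext x i
  simp [MeasurableEquiv.piCongrLeft, Equiv.piCongrLeft, Equiv.piCongrLeft']

theorem measurePreserving_eval_prodMk_eval {ι : Type*} [Fintype ι] (μ : Measure X)
    [IsProbabilityMeasure μ] {i j : ι} (hij : i ≠ j) :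
    MeasurePreserving (fun x : ι → X => (x i, x j)) (Measure.pi fun _ => μ) (μ.prod μ) := by
  have hindep := (ProbabilityTheory.iIndepFun_pi (μ := fun _ : ι => μ) (X := fun _ x => x)
    fun _ => aemeasurable_id).indepFun hij
  refine ⟨by fun_prop, ?_⟩
  rw [(ProbabilityTheory.indepFun_iff_map_prod_eq_prod_map_map (measurable_pi_apply i).aemeasurable
    (measurable_pi_apply j).aemeasurable).1 hindep, (measurePreserving_eval _ i).map_eq,
    (measurePreserving_eval _ j).map_eq]

theorem meanField_eq_lintegral_prod {c : X → X → ℝ≥0∞} (hc : Measurable (Function.uncurry c))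
    (μ : Measure X) [SFinite μ] : meanField c μ = ∫⁻ z, c z.1 z.2 ∂(μ.prod μ) :=
  (lintegral_prod _ hc.aemeasurable).symm

theorem meanField_smul (c : X → X → ℝ≥0∞) (a : ℝ≥0∞) (ha : a ≠ ⊤) (μ : Measure X) :
    meanField c (a • μ) = a ^ 2 * meanField c μ := by
  simp only [meanField, lintegral_smul_measure, smul_eq_mul]
  rw [lintegral_const_mul' _ _ ha, sq, mul_assoc]

theorem otCost_le_mul_meanField {c : X → X → ℝ≥0∞} (hc : Measurable (Function.uncurry c)) (N : ℕ)
    (μ : Measure X) [IsProbabilityMeasure μ] :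
    otCost c N μ ≤ (N * (N - 1 : ℕ)) * meanField c μ := by
  have hpair : ∀ p ∈ (Finset.univ : Finset (Fin N)).offDiag,
      ∫⁻ x, c (x p.1) (x p.2) ∂(Measure.pi fun _ => μ) = meanField c μ := fun p hp => by
    rw [meanField_eq_lintegral_prod hc]
    exact (measurePreserving_eval_prodMk_eval μ (Finset.mem_offDiag.1 hp).2.2).lintegral_comp hc
  refine (iInf₂_le _ (pi_mem_symPlans N μ)).trans_eq ?_
  rw [lintegral_finsetSum _ fun p _ => by fun_prop, Finset.sum_congr rfl hpair]
  simp [Finset.offDiag_card, ← Nat.mul_sub_one]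

theorem otCost_le_sq_mul_meanField {c : X → X → ℝ≥0∞} (hc : Measurable (Function.uncurry c))
    (N : ℕ) (μ : Measure X) [IsProbabilityMeasure μ] :
    otCost c N μ ≤ (N : ℝ≥0∞) ^ 2 * meanField c μ := by
  refine (otCost_le_mul_meanField hc N μ).trans ?_
  rw [sq]
  gcongr
  exact N.sub_le 1

theorem otCost_eq_zero_of_le_one (c : X → X → ℝ≥0∞) {N : ℕ} (hN : N ≤ 1) (μ : Measure X)
    [IsProbabilityMeasure μ] : otCost c N μ = 0 := by
  have : Subsingleton (Fin N) := Fin.subsingleton_iff_le_one.2 hN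
  have hempty : (Finset.univ : Finset (Fin N)).offDiag = ∅ :=
    Finset.eq_empty_of_forall_notMem fun p hp =>
      (Finset.mem_offDiag.1 hp).2.2 (Subsingleton.elim _ _)
  refine le_antisymm ((iInf₂_le _ (pi_mem_symPlans N μ)).trans_eq ?_) bot_le
  simp [hempty]

theorem tsum_add_two_mul_otCost (c : X → X → ℝ≥0∞) (α : ℕ → ℝ≥0∞) (ν : ℕ → Measure X)
    [∀ n, IsProbabilityMeasure (ν n)] :
    ∑' n, α (n + 2) * otCost c (n + 2) (ν (n + 2)) = ∑' n, α n * otCost c n (ν n) := by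
  rw [← ENNReal.summable.sum_add_tsum_nat_add' (f := fun n => α n * otCost c n (ν n)) (k := 2),
    Finset.sum_eq_zero, zero_add]
  intro n hn
  rw [otCost_eq_zero_of_le_one c (Nat.le_of_lt_succ (Finset.mem_range.1 hn)), mul_zero]

theorem gcCost_le_lintegral_otCost (c : X → X → ℝ≥0∞) {N : ℝ} (μ : Measure X)
    [IsProbabilityMeasure μ] (P : Measure ℕ) [IsProbabilityMeasure P]
    (hP : ∫⁻ n, (n : ℝ≥0∞) ∂P = ENNReal.ofReal N) :
    gcCost c N μ ≤ ∫⁻ n, otCost c n μ ∂P := by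
  have hmem : (fun n => P {n}, fun _ => μ) ∈ gcCompetitors N μ := by
    refine ⟨fun _ => inferInstance, ?_, ?_⟩
    · simpa [lintegral_countable'] using lintegral_one (μ := P)
    · ext s hs
      simp [← hP, lintegral_countable', Measure.sum_apply _ hs, ENNReal.tsum_mul_right]
  refine (iInf₂_le _ hmem).trans_eq ?_
  rw [tsum_add_two_mul_otCost c (fun n => P {n}) fun _ => μ, lintegral_countable']
  simp only [mul_comm]

theorem gcCost_le_otCost (c : X → X → ℝ≥0∞) (N : ℕ) (μ : Measure X) [IsProbabilityMeasure μ] :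
    gcCost c N μ ≤ otCost c N μ := by
  simpa using gcCost_le_lintegral_otCost c μ (Measure.dirac N) (N := N) (by simp)

theorem lintegral_natCast_mul_poissonMeasure (r : NNReal) (f : ℕ → ℝ≥0∞) :
    ∫⁻ n, n * f (n - 1) ∂(ProbabilityTheory.poissonMeasure r) =
      r * ∫⁻ n, f n ∂(ProbabilityTheory.poissonMeasure r) := by
  have hstep : ∀ n : ℕ, ((n + 1 : ℕ) : ℝ≥0∞) * ProbabilityTheory.poissonMeasure r {n + 1} =
      r * ProbabilityTheory.poissonMeasure r {n} := fun n => by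
    rw [ProbabilityTheory.poissonMeasure_singleton, ProbabilityTheory.poissonMeasure_singleton,
      ← ENNReal.ofReal_natCast, ← ENNReal.ofReal_coe_nnreal, ← ENNReal.ofReal_mul (by positivity),
      ← ENNReal.ofReal_mul (by positivity), Nat.factorial_succ]
    congr 1
    push_cast
    field_simp
    ring
  rw [lintegral_countable', lintegral_countable', tsum_eq_zero_add' ENNReal.summable,
    ← ENNReal.tsum_mul_left]
  simp only [Nat.cast_zero, zero_mul, zero_add, Nat.add_sub_cancel]
  refine tsum_congr fun n => ?_
  rw [mul_right_comm, hstep, mul_assoc, mul_comm (f n)]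

/-- The Poisson ensemble of independent particles is the exact mean-field competitor: its
factorial moments `E[n] = N` and `E[n (n - 1)] = N ^ 2` hold for every real `N`. -/
theorem gcCost_le_sq_mul_meanField {c : X → X → ℝ≥0∞} (hc : Measurable (Function.uncurry c)) (N : ℝ)
    (μ : Measure X) [IsProbabilityMeasure μ] :
    gcCost c N μ ≤ ENNReal.ofReal N ^ 2 * meanField c μ := by
  set P := ProbabilityTheory.poissonMeasure N.toNNReal
  have hmean : ∫⁻ n, (n : ℝ≥0∞) ∂P = ENNReal.ofReal N := by
    simpa [ENNReal.ofReal] using lintegral_natCast_mul_poissonMeasure N.toNNReal 1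
  calc gcCost c N μ ≤ ∫⁻ n, otCost c n μ ∂P := gcCost_le_lintegral_otCost c μ P hmean
    _ ≤ ∫⁻ n, n * (n - 1 : ℕ) * meanField c μ ∂P :=
        lintegral_mono fun n => otCost_le_mul_meanField hc n μ
    _ = ENNReal.ofReal N ^ 2 * meanField c μ := by
        rw [lintegral_mul_const _ .of_discrete,
          lintegral_natCast_mul_poissonMeasure _ fun n => (n : ℝ≥0∞), hmean, sq, ENNReal.ofReal]

end MultiMarginal

section Superposition

theorem two_mul_mul_le_add_sq {R : Type*} [CommSemiring R] [LinearOrder R]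
    [CanonicallyOrderedAdd R] (a b : R) : 2 * a * b ≤ a ^ 2 + b ^ 2 := by
  wlog h : a ≤ b generalizing a b
  · simpa only [mul_right_comm, add_comm] using this b a (le_of_not_ge h)
  obtain ⟨c, rfl⟩ := exists_add_of_le h
  calc 2 * a * (a + c) ≤ 2 * a * (a + c) + c ^ 2 := le_self_add
    _ = a ^ 2 + (a + c) ^ 2 := by ring

/-- The tangent line at `m` of the parabola `a ↦ a ^ 2 - a`, truncated at `0`. A region holding
`n` particles contains `n ^ 2 - n` ordered pairs, and the affine lower bound depends on the
expected number of particles only. -/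
noncomputable def pairTangent (m a : ℝ≥0∞) : ℝ≥0∞ := 2 * m * a - (a + m ^ 2)

theorem measurable_pairTangent : Measurable (Function.uncurry pairTangent) := by
  unfold pairTangent
  fun_prop

theorem pairTangent_tsum_le {ι : Type*} (m : ℝ≥0∞) {α : ι → ℝ≥0∞} (hα : ∑' i, α i = 1)
    (a : ι → ℝ≥0∞) : pairTangent m (∑' i, α i * a i) ≤ ∑' i, α i * pairTangent m (a i) := by
  refine tsub_le_iff_right.2 ?_
  calc 2 * m * ∑' i, α i * a i = ∑' i, α i * (2 * m * a i) := by
        rw [← ENNReal.tsum_mul_left]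
        exact tsum_congr fun i => mul_left_comm _ _ _
    _ ≤ ∑' i, α i * (pairTangent m (a i) + (a i + m ^ 2)) := by
        gcongr
        exact le_tsub_add
    _ = ∑' i, α i * pairTangent m (a i) + (∑' i, α i * a i + m ^ 2) := by
        simp only [mul_add, ENNReal.tsum_add, ENNReal.tsum_mul_right, hα, one_mul]

theorem sq_le_pairTangent_self_add_min {m : ℝ≥0∞} (hm : m ≠ ⊤) :
    m ^ 2 ≤ pairTangent m m + min m (m ^ 2) := by
  rw [← min_add_add_left, le_min_iff]
  refine ⟨?_, le_add_self⟩
  have hm2 : m ^ 2 ≠ ⊤ := ENNReal.pow_ne_top hm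
  refine (ENNReal.add_le_add_iff_right hm2).1 ?_
  calc m ^ 2 + m ^ 2 = 2 * m * m := by ring
    _ ≤ pairTangent m m + (m + m ^ 2) := le_tsub_add
    _ = pairTangent m m + m + m ^ 2 := (add_assoc _ _ _).symm

variable {X : Type*} [MeasurableSpace X]

theorem two_mul_sum_le_sum_offDiag_add {ι : Type*} [Fintype ι] (m : ℝ≥0∞) {t : ι → ℝ≥0∞}
    (ht : ∀ i, t i ≤ 1) :
    2 * m * ∑ i, t i ≤ ∑ p ∈ (Finset.univ : Finset ι).offDiag, t p.1 * t p.2 +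
      (∑ i, t i + m ^ 2) := by
  classical
  refine (two_mul_mul_le_add_sq _ _).trans ?_
  rw [← add_assoc, add_comm (m ^ 2)]
  gcongr
  rw [sq, Finset.sum_mul_sum, ← Finset.sum_product', ← Finset.diag_union_offDiag,
    Finset.sum_union (Finset.disjoint_diag_offDiag _), Finset.sum_diag, add_comm]
  gcongr with i
  exact mul_le_of_le_one_left' (ht i)

theorem lintegral_sum_eval {n : ℕ} {ν : Measure X} {γ : Measure (Fin n → X)}
    (hγ : γ ∈ symPlans n ν) {χ : X → ℝ≥0∞} (hχ : Measurable χ) :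
    ∫⁻ x, ∑ i, χ (x i) ∂γ = n * ∫⁻ x, χ x ∂ν := by
  have hmarginal : ∀ i : Fin n, ∫⁻ x, χ (x i) ∂γ = ∫⁻ x, χ x ∂ν := fun i => by
    rw [← hγ.2.2 i, lintegral_map hχ (measurable_pi_apply i)]
  rw [lintegral_finsetSum _ fun i _ => by fun_prop]
  simp [hmarginal]

theorem pairTangent_le_lintegral_offDiag {n : ℕ} {ν : Measure X} {γ : Measure (Fin n → X)}
    (hγ : γ ∈ symPlans n ν) {χ : X → ℝ≥0∞} (hχ : Measurable χ) (hχ1 : ∀ x, χ x ≤ 1) (m : ℝ≥0∞) :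
    pairTangent m (n * ∫⁻ x, χ x ∂ν) ≤
      ∫⁻ x, ∑ p ∈ (Finset.univ : Finset (Fin n)).offDiag, χ (x p.1) * χ (x p.2) ∂γ := by
  have := hγ.1
  refine tsub_le_iff_right.2 ?_
  calc 2 * m * (n * ∫⁻ x, χ x ∂ν) = ∫⁻ x, 2 * m * ∑ i, χ (x i) ∂γ := by
        rw [lintegral_const_mul _ (by fun_prop), lintegral_sum_eval hγ hχ]
    _ ≤ ∫⁻ x, ∑ p ∈ (Finset.univ : Finset (Fin n)).offDiag, χ (x p.1) * χ (x p.2) +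
          (∑ i, χ (x i) + m ^ 2) ∂γ :=
        lintegral_mono fun x => two_mul_sum_le_sum_offDiag_add m fun i => hχ1 (x i)
    _ = _ := by
        rw [lintegral_add_right _ (by fun_prop), lintegral_add_right _ measurable_const,
          lintegral_sum_eval hγ hχ, lintegral_const, measure_univ, mul_one]

variable {P : Type*} [MeasurableSpace P] {Λ : Measure P} [SFinite Λ] {χ : P → X → ℝ≥0∞}
  (hχ : Measurable (Function.uncurry χ)) {c : X → X → ℝ≥0∞}
  (hc : ∀ x y, c x y = ∫⁻ p, χ p x * χ p y ∂Λ)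
include hχ hc

theorem meanField_eq_lintegral_sq (μ : Measure X) [SFinite μ] :
    meanField c μ = ∫⁻ p, (∫⁻ x, χ p x ∂μ) ^ 2 ∂Λ := by
  have : Measurable fun p => ∫⁻ y, χ p y ∂μ := hχ.lintegral_prod_right'
  have hpotential : ∀ x, ∫⁻ y, c x y ∂μ = ∫⁻ p, χ p x * ∫⁻ y, χ p y ∂μ ∂Λ := fun x => by
    simp only [hc]
    rw [lintegral_lintegral_swap (by fun_prop)]
    exact lintegral_congr fun p => lintegral_const_mul _ (by fun_prop)
  simp only [meanField, hpotential]
  rw [lintegral_lintegral_swap (by fun_prop)]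
  exact lintegral_congr fun p => by rw [lintegral_mul_const _ (by fun_prop), sq]

variable (hχ1 : ∀ p x, χ p x ≤ 1)
include hχ1

theorem lintegral_pairTangent_le_otCost (n : ℕ) (ν : Measure X) (m : P → ℝ≥0∞) :
    ∫⁻ p, pairTangent (m p) (n * ∫⁻ x, χ p x ∂ν) ∂Λ ≤ otCost c n ν := by
  refine le_iInf₂ fun γ hγ => ?_
  have := hγ.1
  have hpair : ∀ q ∈ (Finset.univ : Finset (Fin n)).offDiag,
      Measurable fun z : P × (Fin n → X) => χ z.1 (z.2 q.1) * χ z.1 (z.2 q.2) :=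
    fun q _ => by fun_prop
  calc _ ≤ ∫⁻ p, ∫⁻ x, ∑ q ∈ (Finset.univ : Finset (Fin n)).offDiag,
          χ p (x q.1) * χ p (x q.2) ∂γ ∂Λ :=
        lintegral_mono fun p =>
          pairTangent_le_lintegral_offDiag hγ (hχ.comp measurable_prodMk_left) (hχ1 p) _
    _ = ∫⁻ x, ∫⁻ p, ∑ q ∈ (Finset.univ : Finset (Fin n)).offDiag,
          χ p (x q.1) * χ p (x q.2) ∂Λ ∂γ :=
        lintegral_lintegral_swap (Finset.measurable_sum _ hpair).aemeasurable
    _ = ∫⁻ x, ∑ q ∈ (Finset.univ : Finset (Fin n)).offDiag, c (x q.1) (x q.2) ∂γ := by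
        simp only [hc]
        exact lintegral_congr fun x =>
          lintegral_finsetSum _ fun q hq => (hpair q hq).comp measurable_prodMk_right

theorem lintegral_pairTangent_le_gcCost (N : ℝ) (μ : Measure X) {m : P → ℝ≥0∞}
    (hm : Measurable m) :
    ∫⁻ p, pairTangent (m p) (∫⁻ x, χ p x ∂(ENNReal.ofReal N • μ)) ∂Λ ≤ gcCost c N μ := by
  refine le_iInf₂ fun ⟨α, ν⟩ ⟨hν, hα, hmean⟩ => ?_
  have hmass : ∀ p, ∫⁻ x, χ p x ∂(ENNReal.ofReal N • μ) =
      ∑' n : ℕ, α n * (n * ∫⁻ x, χ p x ∂(ν n)) := fun p => by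
    simp only [← hmean, lintegral_sum_measure, lintegral_smul_measure, smul_eq_mul]
    exact tsum_congr fun n => by ring
  have hmeas : ∀ n : ℕ, Measurable fun p => pairTangent (m p) (n * ∫⁻ x, χ p x ∂(ν n)) :=
    fun n => measurable_pairTangent.comp
      (hm.prodMk ((Measurable.lintegral_prod_right' (ν := ν n) hχ).const_mul _))
  calc _ ≤ ∫⁻ p, ∑' n : ℕ, α n * pairTangent (m p) (n * ∫⁻ x, χ p x ∂(ν n)) ∂Λ :=
        lintegral_mono fun p => by rw [hmass]; exact pairTangent_tsum_le _ hα _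
    _ = ∑' n : ℕ, α n * ∫⁻ p, pairTangent (m p) (n * ∫⁻ x, χ p x ∂(ν n)) ∂Λ := by
        rw [lintegral_tsum fun n => ((hmeas n).const_mul _).aemeasurable]
        exact tsum_congr fun n => lintegral_const_mul _ (hmeas n)
    _ ≤ ∑' n : ℕ, α n * otCost c n (ν n) := by
        gcongr with n
        exact lintegral_pairTangent_le_otCost hχ hc hχ1 n (ν n) m
    _ = _ := (tsum_add_two_mul_otCost c α ν).symm

theorem meanField_smul_le_gcCost_add (N : ℝ) (μ : Measure X) [IsFiniteMeasure μ] :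
    meanField c (ENNReal.ofReal N • μ) ≤ gcCost c N μ +
      ∫⁻ p, min (∫⁻ x, χ p x ∂(ENNReal.ofReal N • μ))
        ((∫⁻ x, χ p x ∂(ENNReal.ofReal N • μ)) ^ 2) ∂Λ := by
  set M := ENNReal.ofReal N • μ
  have : IsFiniteMeasure M := Measure.smul_finite μ ENNReal.ofReal_ne_top
  have hmass : Measurable fun p => ∫⁻ x, χ p x ∂M := hχ.lintegral_prod_right'
  have hfinite : ∀ p, ∫⁻ x, χ p x ∂M ≠ ⊤ := fun p =>
    ((lintegral_mono (hχ1 p)).trans_lt (by simp)).ne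
  calc meanField c M = ∫⁻ p, (∫⁻ x, χ p x ∂M) ^ 2 ∂Λ := meanField_eq_lintegral_sq hχ hc M
    _ ≤ ∫⁻ p, pairTangent (∫⁻ x, χ p x ∂M) (∫⁻ x, χ p x ∂M) +
          min (∫⁻ x, χ p x ∂M) ((∫⁻ x, χ p x ∂M) ^ 2) ∂Λ :=
        lintegral_mono fun p => sq_le_pairTangent_self_add_min (hfinite p)
    _ = ∫⁻ p, pairTangent (∫⁻ x, χ p x ∂M) (∫⁻ x, χ p x ∂M) ∂Λ +
          ∫⁻ p, min (∫⁻ x, χ p x ∂M) ((∫⁻ x, χ p x ∂M) ^ 2) ∂Λ :=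
        lintegral_add_right _ (hmass.min (hmass.pow_const 2))
    _ ≤ _ := by
        gcongr
        exact lintegral_pairTangent_le_gcCost hχ hc hχ1 N μ hmass

end Superposition

section PowerIntegrals

theorem setLIntegral_Ioi_rpow {a s : ℝ} (ha : 0 < a) (hs : 0 < s) :
    ∫⁻ r in Set.Ioi a, ENNReal.ofReal (r ^ (-s - 1)) = ENNReal.ofReal (a ^ (-s) / s) := by
  rw [← ofReal_integral_eq_lintegral_ofReal (integrableOn_Ioi_rpow_of_lt (by linarith) ha)
    ((ae_restrict_iff' measurableSet_Ioi).2 (.of_forall fun r hr =>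
      Real.rpow_nonneg (ha.trans hr).le _)), integral_Ioi_rpow_of_lt (by linarith) ha,
    sub_add_cancel, neg_div_neg_eq]

theorem setLIntegral_Ioc_zero_rpow {a q : ℝ} (ha : 0 ≤ a) (hq : 0 < q) :
    ∫⁻ r in Set.Ioc 0 a, ENNReal.ofReal (r ^ (q - 1)) = ENNReal.ofReal (a ^ q / q) := by
  have hint : IntervalIntegrable (fun r : ℝ => r ^ (q - 1)) volume 0 a :=
    intervalIntegral.intervalIntegrable_rpow' (by linarith)
  rw [← ofReal_integral_eq_lintegral_ofReal
    ((intervalIntegrable_iff_integrableOn_Ioc_of_le ha).1 hint)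
    ((ae_restrict_iff' measurableSet_Ioc).2 (.of_forall fun r hr =>
      Real.rpow_nonneg hr.1.le _)), ← intervalIntegral.integral_of_le ha,
    integral_rpow (Or.inl (by linarith))]
  simp [hq.ne']

theorem setLIntegral_Ioi_zero_rpow (a : ℝ) :
    ∫⁻ r in Set.Ioi (0 : ℝ), ENNReal.ofReal (r ^ a) = ⊤ := by
  by_contra h
  refine not_integrableOn_Ioi_rpow a ⟨by fun_prop, ?_⟩
  rw [hasFiniteIntegral_iff_ofReal ((ae_restrict_iff' measurableSet_Ioi).2 (.of_forall
    fun r hr => Real.rpow_nonneg (le_of_lt hr) _))]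
  exact lt_top_iff_ne_top.2 h

theorem setLIntegral_Ioi_zero_comp_mul_left {t : ℝ} (ht : 0 < t) (g : ℝ → ℝ≥0∞) :
    ∫⁻ r in Set.Ioi 0, g r = ENNReal.ofReal t * ∫⁻ r in Set.Ioi 0, g (t * r) := by
  have himage : (t * ·) '' Set.Ioi 0 = Set.Ioi 0 := by
    simpa using Set.image_mul_left_Ioi ht (0 : ℝ)
  rw [← lintegral_const_mul' _ _ ENNReal.ofReal_ne_top]
  conv_lhs => rw [← himage]
  rw [lintegral_image_eq_lintegral_abs_deriv_mul measurableSet_Ioi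
    (fun r _ => (hasDerivAt_const_mul t).hasDerivWithinAt) (mul_right_injective₀ ht.ne').injOn,
    abs_of_pos ht]

end PowerIntegrals

section BallKernel

open Metric Module
open scoped Pointwise

/-- The indicator function of the ball with radius `p.1` and centre `p.2`. -/
noncomputable def ballInd {E : Type*} [PseudoMetricSpace E] (p : ℝ × E) : E → ℝ≥0∞ :=
  (ball p.2 p.1).indicator 1

theorem ballInd_le_one {E : Type*} [PseudoMetricSpace E] (p : ℝ × E) (x : E) : ballInd p x ≤ 1 :=
  Set.indicator_le_self' (fun _ _ => zero_le) x

theorem measurable_ballInd {E : Type*} [PseudoMetricSpace E] [MeasurableSpace E]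
    [OpensMeasurableSpace E] [SecondCountableTopology E] :
    Measurable (Function.uncurry (ballInd (E := E))) := by
  have hs : MeasurableSet {q : (ℝ × E) × E | dist q.2 q.1.2 < q.1.1} :=
    measurableSet_lt (by fun_prop) (by fun_prop)
  exact measurable_one.indicator hs

theorem lintegral_ballInd {E : Type*} [PseudoMetricSpace E] [MeasurableSpace E]
    [OpensMeasurableSpace E] (p : ℝ × E) (μ : Measure E) :
    ∫⁻ x, ballInd p x ∂μ = μ (ball p.2 p.1) :=
  lintegral_indicator_one measurableSet_ball

variable {E : Type*} [NormedAddCommGroup E] [InnerProductSpace ℝ E] [FiniteDimensional ℝ E]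
  [MeasurableSpace E] [BorelSpace E]

theorem ofReal_rpow_mul_volume_ball (a : ℝ) {r : ℝ} (hr : 0 < r) (x : E) :
    ENNReal.ofReal (r ^ (a - finrank ℝ E)) * volume (ball x r) =
      ENNReal.ofReal (r ^ a) * volume (ball (0 : E) 1) := by
  rw [Measure.addHaar_ball_of_pos _ _ hr, ← mul_assoc, ← ENNReal.ofReal_mul (by positivity),
    ← Real.rpow_natCast, ← Real.rpow_add hr, sub_add_cancel]

/-- The measure `r ^ (-s - 1 - d) dr dz` on the balls of a `d`-dimensional space, with radius
`r > 0` and centre `z`. -/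
noncomputable def scaleMeasure (E : Type*) [NormedAddCommGroup E] [InnerProductSpace ℝ E]
    [FiniteDimensional ℝ E] [MeasurableSpace E] [BorelSpace E] (s : ℝ) : Measure (ℝ × E) :=
  ((volume.restrict (Set.Ioi 0)).withDensity fun r : ℝ =>
    ENNReal.ofReal (r ^ (-s - 1 - finrank ℝ E))).prod volume

instance scaleMeasure.instSFinite (s : ℝ) : SFinite (scaleMeasure E s) := by
  unfold scaleMeasure; infer_instance

theorem lintegral_scaleMeasure (s : ℝ) {g : ℝ × E → ℝ≥0∞} (hg : Measurable g) :
    ∫⁻ p, g p ∂(scaleMeasure E s) = ∫⁻ r in Set.Ioi (0 : ℝ),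
      ENNReal.ofReal (r ^ (-s - 1 - finrank ℝ E)) * ∫⁻ z, g (r, z) := by
  rw [scaleMeasure, lintegral_prod _ hg.aemeasurable,
    lintegral_withDensity_eq_lintegral_mul _ (by fun_prop) hg.lintegral_prod_right']
  rfl

/-- The measure `scaleMeasure E s` of the set of balls containing both `x` and `y`. -/
noncomputable def ballKernel (s : ℝ) (x y : E) : ℝ≥0∞ :=
  ∫⁻ p, ballInd p x * ballInd p y ∂(scaleMeasure E s)

theorem ballKernel_eq (s : ℝ) (x y : E) :
    ballKernel s x y = ∫⁻ r in Set.Ioi (0 : ℝ),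
      ENNReal.ofReal (r ^ (-s - 1 - finrank ℝ E)) * volume (ball x r ∩ ball y r) := by
  have hmeas : ∀ x : E, Measurable fun p : ℝ × E => ballInd p x := fun x =>
    measurable_ballInd.comp measurable_prodMk_right
  rw [ballKernel, lintegral_scaleMeasure s (g := fun p => ballInd p x * ballInd p y)
    ((hmeas x).mul (hmeas y))]
  refine lintegral_congr fun r => congrArg _ ?_
  rw [← lintegral_indicator_one (measurableSet_ball.inter measurableSet_ball)]
  refine lintegral_congr fun z => ?_
  rw [Set.inter_indicator_one, Pi.mul_apply]
  simp only [ballInd, Set.indicator, mem_ball, dist_comm z, Pi.one_apply]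

theorem ballKernel_eq_zero_sub (s : ℝ) (x y : E) :
    ballKernel s x y = ballKernel s 0 (y - x) := by
  simp only [ballKernel_eq]
  refine lintegral_congr fun r => congrArg _ ?_
  rw [← measure_preimage_add volume x]
  congr 1
  ext z
  simp [dist_eq_norm, add_sub_assoc, sub_sub_eq_add_sub, add_comm]

theorem ballKernel_zero_eq_of_norm_eq (s : ℝ) {v w : E} (h : ‖v‖ = ‖w‖) :
    ballKernel s 0 v = ballKernel s 0 w := by
  simp only [ballKernel_eq]
  refine lintegral_congr fun r => congrArg _ ?_
  let φ : E ≃ₗᵢ[ℝ] E := (Submodule.span ℝ {v - w})ᗮ.reflection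
  have hφ : φ v = w := Submodule.reflection_sub h
  rw [← φ.measurePreserving.measure_preimage (s := ball 0 r ∩ ball w r)
    (measurableSet_ball.inter measurableSet_ball).nullMeasurableSet]
  congr 1
  ext z
  simp [← hφ]

theorem ballKernel_zero_smul (s : ℝ) {t : ℝ} (ht : 0 < t) (v : E) :
    ballKernel s 0 (t • v) = ENNReal.ofReal (t ^ (-s)) * ballKernel s 0 v := by
  rw [ballKernel_eq, ballKernel_eq, setLIntegral_Ioi_zero_comp_mul_left ht,
    ← lintegral_const_mul' _ _ ENNReal.ofReal_ne_top,
    ← lintegral_const_mul' _ _ ENNReal.ofReal_ne_top]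
  refine setLIntegral_congr_fun measurableSet_Ioi fun r (hr : 0 < r) => ?_
  have hvolume : volume (ball (0 : E) (t * r) ∩ ball (t • v) (t * r)) =
      ENNReal.ofReal (t ^ finrank ℝ E) * volume (ball (0 : E) r ∩ ball v r) := by
    rw [← abs_of_pos (pow_pos ht (finrank ℝ E)), ← Measure.addHaar_smul,
      Set.smul_set_inter₀ ht.ne', _root_.smul_ball ht.ne', _root_.smul_ball ht.ne', smul_zero,
      Real.norm_of_nonneg ht.le]
  have hpower : t * ((t * r) ^ (-s - 1 - finrank ℝ E) * t ^ finrank ℝ E) =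
      t ^ (-s) * r ^ (-s - 1 - finrank ℝ E) := by
    rw [Real.mul_rpow ht.le hr.le, mul_right_comm, ← Real.rpow_natCast, ← Real.rpow_add ht,
      sub_add_cancel, ← mul_assoc, Real.rpow_sub_one ht.ne', mul_div_cancel₀ _ ht.ne']
  rw [hvolume, ← mul_assoc, ← mul_assoc, ← mul_assoc, ← ENNReal.ofReal_mul (by positivity),
    ← ENNReal.ofReal_mul (by positivity), ← ENNReal.ofReal_mul (by positivity), mul_assoc t,
    hpower]

theorem ballKernel_self (s : ℝ) (x : E) : ballKernel s x x = ⊤ := by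
  simp only [ballKernel_eq, Set.inter_self]
  rw [setLIntegral_congr_fun measurableSet_Ioi fun r hr => ofReal_rpow_mul_volume_ball _ hr x,
    lintegral_mul_const _ (by fun_prop), setLIntegral_Ioi_zero_rpow,
    ENNReal.top_mul (measure_ball_pos volume _ one_pos).ne']

theorem ball_half_smul_subset {E : Type*} [NormedAddCommGroup E] [NormedSpace ℝ E] {e : E}
    (he : ‖e‖ = 1) {r : ℝ} (hr : 1 ≤ r) :
    ball ((2⁻¹ : ℝ) • e) (2⁻¹ * r) ⊆ ball 0 r ∩ ball e r := by
  have hnorm : ‖(2⁻¹ : ℝ) • e‖ = 2⁻¹ := by rw [norm_smul, he]; norm_num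
  refine Set.subset_inter (ball_subset_ball' ?_) (ball_subset_ball' ?_)
  · rw [dist_zero_right, hnorm]
    linarith
  · rw [dist_eq_norm, show (2⁻¹ : ℝ) • e - e = -((2⁻¹ : ℝ) • e) by module, norm_neg, hnorm]
    linarith

theorem le_ballKernel_of_norm_eq_one {s : ℝ} (hs : 0 < s) {e : E} (he : ‖e‖ = 1) :
    ENNReal.ofReal (2⁻¹ ^ finrank ℝ E) * (ENNReal.ofReal (1 / s) * volume (ball (0 : E) 1)) ≤
      ballKernel s 0 e := by
  rw [ballKernel_eq]
  calc _ = ∫⁻ r in Set.Ioi (1 : ℝ), ENNReal.ofReal (2⁻¹ ^ finrank ℝ E) *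
        (ENNReal.ofReal (r ^ (-s - 1)) * volume (ball (0 : E) 1)) := by
        rw [lintegral_const_mul _ (by fun_prop), lintegral_mul_const _ (by fun_prop),
          setLIntegral_Ioi_rpow one_pos hs, Real.one_rpow]
    _ ≤ ∫⁻ r in Set.Ioi (1 : ℝ), ENNReal.ofReal (r ^ (-s - 1 - finrank ℝ E)) *
        volume (ball 0 r ∩ ball e r) := by
        refine setLIntegral_mono' measurableSet_Ioi fun r (hr : 1 < r) => ?_
        rw [← ofReal_rpow_mul_volume_ball _ (one_pos.trans hr) 0, mul_left_comm,
          ← Measure.addHaar_ball_mul_of_pos volume ((2⁻¹ : ℝ) • e) (by norm_num)]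
        gcongr
        exact ball_half_smul_subset he hr.le
    _ ≤ _ := lintegral_mono_set (Set.Ioi_subset_Ioi zero_le_one)

theorem ballKernel_pos_of_norm_eq_one {s : ℝ} (hs : 0 < s) {e : E} (he : ‖e‖ = 1) :
    0 < ballKernel s 0 e := by
  refine lt_of_lt_of_le ?_ (le_ballKernel_of_norm_eq_one hs he)
  have := measure_ball_pos volume (0 : E) one_pos
  positivity

theorem ballKernel_lt_top_of_norm_eq_one {s : ℝ} (hs : 0 < s) {e : E} (he : ‖e‖ = 1) :
    ballKernel s 0 e < ⊤ := by
  have hdisjoint : ∀ r ≤ (2⁻¹ : ℝ), ball (0 : E) r ∩ ball e r = ∅ := fun r hr =>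
    (ball_disjoint_ball (by rw [dist_zero_left, he]; linarith)).inter_eq
  rw [ballKernel_eq]
  calc _ ≤ ∫⁻ r, ENNReal.ofReal (r ^ (-s - 1 - finrank ℝ E)) *
          volume (ball (0 : E) r ∩ ball e r) := setLIntegral_le_lintegral _ _
    _ = ∫⁻ r in Set.Ioi (2⁻¹ : ℝ), ENNReal.ofReal (r ^ (-s - 1 - finrank ℝ E)) *
          volume (ball (0 : E) r ∩ ball e r) :=
        (setLIntegral_eq_of_support_subset (Function.support_subset_iff'.2 fun r hr => by
          rw [hdisjoint r (not_lt.1 hr), measure_empty, mul_zero])).symm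
    _ ≤ ∫⁻ r in Set.Ioi (2⁻¹ : ℝ), ENNReal.ofReal (r ^ (-s - 1)) * volume (ball (0 : E) 1) := by
        refine setLIntegral_mono' measurableSet_Ioi fun r (hr : 2⁻¹ < r) => ?_
        rw [← ofReal_rpow_mul_volume_ball _ (lt_trans (by norm_num) hr) 0]
        gcongr
        exact Set.inter_subset_left
    _ < ⊤ := by
        rw [lintegral_mul_const _ (by fun_prop), setLIntegral_Ioi_rpow (by norm_num) hs]
        exact ENNReal.mul_lt_top ENNReal.ofReal_lt_top measure_ball_lt_top

/-- The power-law cost `|x - y| ^ (-s)`; for `s > 0` it is `∞` on the diagonal. -/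
noncomputable def powerCost {X : Type*} [EDist X] (s : ℝ) (x y : X) : ℝ≥0∞ := edist x y ^ (-s)

theorem measurable_uncurry_powerCost {X : Type*} [PseudoEMetricSpace X] [MeasurableSpace X]
    [OpensMeasurableSpace X] [SecondCountableTopology X] (s : ℝ) :
    Measurable (Function.uncurry (powerCost (X := X) s)) :=
  measurable_edist.pow_const _

theorem ballKernel_eq_mul_powerCost {s : ℝ} (hs : 0 < s) {e : E} (he : ‖e‖ = 1) (x y : E) :
    ballKernel s x y = ballKernel s 0 e * powerCost s x y := by
  rcases eq_or_ne x y with rfl | hxy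
  · rw [ballKernel_self, powerCost, edist_self, ENNReal.zero_rpow_of_neg (neg_neg_of_pos hs),
      ENNReal.mul_top (ballKernel_pos_of_norm_eq_one hs he).ne']
  · have hdist : 0 < ‖y - x‖ := norm_pos_iff.2 (sub_ne_zero.2 hxy.symm)
    have hnorm : ‖y - x‖ = ‖‖y - x‖ • e‖ := by rw [norm_smul, he, norm_norm, mul_one]
    rw [ballKernel_eq_zero_sub, ballKernel_zero_eq_of_norm_eq s hnorm,
      ballKernel_zero_smul s hdist, mul_comm, powerCost, edist_comm, edist_dist, dist_eq_norm,
      ENNReal.ofReal_rpow_of_pos hdist]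

theorem powerCost_eq_lintegral_ballInd {s : ℝ} (hs : 0 < s) {e : E} (he : ‖e‖ = 1) (x y : E) :
    powerCost s x y =
      ∫⁻ p, ballInd p x * ballInd p y ∂((ballKernel s 0 e)⁻¹ • scaleMeasure E s) := by
  rw [lintegral_smul_measure, ← ballKernel, ballKernel_eq_mul_powerCost hs he x y, smul_eq_mul,
    ENNReal.inv_mul_cancel_left (ballKernel_pos_of_norm_eq_one hs he).ne'
      (ballKernel_lt_top_of_norm_eq_one hs he).ne]

end BallKernel

section Fluctuation

open Metric Module

theorem min_add_sq_le (a b : ℝ≥0∞) : min (a + b) ((a + b) ^ 2) ≤ 2 * a + 4 * b ^ 2 := by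
  rcases le_total b a with h | h
  · calc min (a + b) ((a + b) ^ 2) ≤ a + a := (min_le_left _ _).trans (by gcongr)
      _ ≤ 2 * a + 4 * b ^ 2 := by rw [← two_mul]; exact le_self_add
  · calc min (a + b) ((a + b) ^ 2) ≤ (b + b) ^ 2 := (min_le_right _ _).trans (by gcongr)
      _ = 4 * b ^ 2 := by ring
      _ ≤ 2 * a + 4 * b ^ 2 := le_add_self

theorem sq_lintegral_le {X : Type*} [MeasurableSpace X] (μ : Measure X) {g : X → ℝ≥0∞}
    (hg : AEMeasurable g μ) : (∫⁻ x, g x ∂μ) ^ 2 ≤ μ Set.univ * ∫⁻ x, g x ^ 2 ∂μ := by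
  have h := ENNReal.lintegral_mul_le_Lp_mul_Lq μ Real.HolderConjugate.two_two
    (aemeasurable_const (b := (1 : ℝ≥0∞))) hg
  simp only [Pi.mul_apply, one_mul, ENNReal.rpow_two, one_pow, lintegral_one] at h
  calc (∫⁻ x, g x ∂μ) ^ 2
      ≤ (μ Set.univ ^ (1 / 2 : ℝ) * (∫⁻ x, g x ^ 2 ∂μ) ^ (1 / 2 : ℝ)) ^ 2 := by gcongr
    _ = μ Set.univ * ∫⁻ x, g x ^ 2 ∂μ := by
        rw [mul_pow, ← ENNReal.rpow_two, ← ENNReal.rpow_two, ← ENNReal.rpow_mul,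
          ← ENNReal.rpow_mul]
        norm_num

section Sections

variable {α β : Type*} [MeasurableSpace α] [MeasurableSpace β] {S : Set (α × β)}
  (hS : MeasurableSet S) {h : β → ℝ≥0∞} (hh : Measurable h)
include hS hh

theorem measurable_setLIntegral_section (ν : Measure β) [SFinite ν] :
    Measurable fun a => ∫⁻ b in {b | (a, b) ∈ S}, h b ∂ν := by
  have hsection : ∀ a, ∫⁻ b in {b | (a, b) ∈ S}, h b ∂ν =
      ∫⁻ b, S.indicator (fun z => h z.2) (a, b) ∂ν := fun a =>
    (lintegral_indicator (hS.preimage measurable_prodMk_left) h).symm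
  simp only [hsection]
  exact ((hh.comp measurable_snd).indicator hS).lintegral_prod_right'

theorem lintegral_mul_setLIntegral_section_swap (μ : Measure α) (ν : Measure β) [SFinite μ]
    [SFinite ν] {g : α → ℝ≥0∞} (hg : Measurable g) :
    ∫⁻ a, g a * ∫⁻ b in {b | (a, b) ∈ S}, h b ∂ν ∂μ =
      ∫⁻ b, h b * ∫⁻ a in {a | (a, b) ∈ S}, g a ∂μ ∂ν := by
  calc _ = ∫⁻ a, ∫⁻ b, S.indicator (fun z => g z.1 * h z.2) (a, b) ∂ν ∂μ :=
        lintegral_congr fun a => by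
          rw [← lintegral_const_mul _ hh]
          exact (lintegral_indicator (hS.preimage measurable_prodMk_left) _).symm
    _ = ∫⁻ b, ∫⁻ a, S.indicator (fun z => g z.1 * h z.2) (a, b) ∂μ ∂ν :=
        lintegral_lintegral_swap
          (((hg.comp measurable_fst).mul (hh.comp measurable_snd)).indicator hS).aemeasurable
    _ = _ := lintegral_congr fun b => by
        rw [← lintegral_const_mul _ hg]
        simp only [mul_comm (h b)]
        exact lintegral_indicator (hS.preimage measurable_prodMk_right) _

end Sections

section Threshold

theorem ofReal_rpow_neg_lt_iff {q r a : ℝ} (hq : 0 < q) (hr : 0 < r) (ha : 0 < a) :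
    ENNReal.ofReal (r ^ (-q)) < ENNReal.ofReal (a ^ (-q)) ↔ a < r := by
  rw [ENNReal.ofReal_lt_ofReal_iff (by positivity),
    Real.rpow_lt_rpow_iff_of_neg hr ha (neg_neg_of_pos hq)]

theorem exists_ofReal_rpow_neg_eq {q : ℝ} (hq : 0 < q) {t : ℝ≥0∞} (h0 : t ≠ 0) (ht : t ≠ ⊤) :
    ∃ a : ℝ, 0 < a ∧ ENNReal.ofReal (a ^ (-q)) = t :=
  ⟨t.toReal ^ (-q)⁻¹, Real.rpow_pos_of_pos (ENNReal.toReal_pos h0 ht) _, by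
    rw [Real.rpow_inv_rpow ENNReal.toReal_nonneg (neg_ne_zero.2 hq.ne'), ENNReal.ofReal_toReal ht]⟩

theorem mul_setLIntegral_rpow_le {s q : ℝ} (hs : 0 < s) (hq : 0 < q) (t : ℝ≥0∞) :
    t * ∫⁻ r in {r : ℝ | ENNReal.ofReal (r ^ (-q)) < t}, ENNReal.ofReal (r ^ (-s - 1))
        ∂(volume.restrict (Set.Ioi 0)) ≤
      ENNReal.ofReal (1 / s) * t ^ (1 + s / q) := by
  rcases eq_or_ne t 0 with rfl | h0
  · simp
  rcases eq_or_ne t ⊤ with rfl | htop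
  · rw [ENNReal.top_rpow_of_pos (by positivity), ENNReal.mul_top (by positivity)]
    exact le_top
  obtain ⟨a, ha, rfl⟩ := exists_ofReal_rpow_neg_eq hq h0 htop
  have hset : {r : ℝ | ENNReal.ofReal (r ^ (-q)) < ENNReal.ofReal (a ^ (-q))} ∩ Set.Ioi 0 =
      Set.Ioi a := by
    ext r
    exact ⟨fun h => (ofReal_rpow_neg_lt_iff hq h.2 ha).1 h.1,
      fun h => ⟨(ofReal_rpow_neg_lt_iff hq (ha.trans h) ha).2 h, ha.trans h⟩⟩
  rw [Measure.restrict_restrict (measurableSet_lt (by fun_prop) (by fun_prop)), hset,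
    setLIntegral_Ioi_rpow ha hs, ENNReal.ofReal_rpow_of_pos (by positivity),
    ← ENNReal.ofReal_mul (by positivity), ← ENNReal.ofReal_mul (by positivity),
    ← Real.rpow_mul ha.le, ← mul_div_assoc, ← Real.rpow_add ha, div_mul_eq_mul_div, one_mul]
  refine le_of_eq ?_
  congr 3
  field_simp
  ring

theorem sq_mul_setLIntegral_rpow_le {s q : ℝ} (hs : 0 < s) (hsq : s < q) (t : ℝ≥0∞) :
    t ^ 2 * ∫⁻ r in {r : ℝ | ¬ ENNReal.ofReal (r ^ (-q)) < t}, ENNReal.ofReal (r ^ (q - s - 1))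
        ∂(volume.restrict (Set.Ioi 0)) ≤
      ENNReal.ofReal (1 / (q - s)) * t ^ (1 + s / q) := by
  have hq : 0 < q := hs.trans hsq
  have hqs : 0 < q - s := sub_pos.2 hsq
  rcases eq_or_ne t 0 with rfl | h0
  · simp
  rcases eq_or_ne t ⊤ with rfl | htop
  · rw [ENNReal.top_rpow_of_pos (by positivity), ENNReal.mul_top (by positivity)]
    exact le_top
  obtain ⟨a, ha, rfl⟩ := exists_ofReal_rpow_neg_eq hq h0 htop
  have hset : {r : ℝ | ¬ ENNReal.ofReal (r ^ (-q)) < ENNReal.ofReal (a ^ (-q))} ∩ Set.Ioi 0 =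
      Set.Ioc 0 a := by
    ext r
    exact ⟨fun h => ⟨h.2, not_lt.1 fun h' => h.1 ((ofReal_rpow_neg_lt_iff hq h.2 ha).2 h')⟩,
      fun h => ⟨fun h' => h.2.not_gt ((ofReal_rpow_neg_lt_iff hq h.1 ha).1 h'), h.1⟩⟩
  have hmeas : MeasurableSet
      {r : ℝ | ¬ ENNReal.ofReal (r ^ (-q)) < ENNReal.ofReal (a ^ (-q))} :=
    (measurableSet_lt (f := fun r : ℝ => ENNReal.ofReal (r ^ (-q))) (by fun_prop)
      measurable_const).compl
  rw [Measure.restrict_restrict hmeas, hset,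
    setLIntegral_Ioc_zero_rpow ha.le hqs, ENNReal.ofReal_rpow_of_pos (by positivity),
    ← ENNReal.ofReal_pow (by positivity), ← ENNReal.ofReal_mul (by positivity),
    ← ENNReal.ofReal_mul (by positivity), ← Real.rpow_mul ha.le, ← Real.rpow_mul_natCast ha.le,
    ← mul_div_assoc, ← Real.rpow_add ha, div_mul_eq_mul_div, one_mul]
  refine le_of_eq ?_
  congr 3
  push_cast
  field_simp
  ring

end Threshold

variable {E : Type*} [NormedAddCommGroup E] [InnerProductSpace ℝ E] [FiniteDimensional ℝ E]
  [MeasurableSpace E] [BorelSpace E]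

theorem lintegral_setLIntegral_ball (r : ℝ) (ν : Measure E) [SFinite ν] {h : E → ℝ≥0∞}
    (hh : Measurable h) :
    ∫⁻ z, ∫⁻ x in ball z r, h x ∂ν = volume (ball (0 : E) r) * ∫⁻ x, h x ∂ν := by
  have hS : MeasurableSet {q : E × E | dist q.2 q.1 < r} :=
    measurableSet_lt (by fun_prop) (by fun_prop)
  have hswap := lintegral_mul_setLIntegral_section_swap hS hh volume ν (g := 1) measurable_one
  have hvolume : ∀ x : E, volume {z | dist x z < r} = volume (ball (0 : E) r) := fun x => by
    simp only [dist_comm x]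
    exact Measure.addHaar_ball_center volume x r
  simp only [Pi.one_apply, one_mul, Set.mem_ofPred_eq, setLIntegral_one, hvolume] at hswap
  exact hswap.trans ((lintegral_mul_const _ hh).trans (mul_comm _ _))

theorem lintegral_min_setLIntegral_ball_le (r : ℝ) {f : E → ℝ≥0∞} (hf : Measurable f) {A : Set E}
    (hA : MeasurableSet A) :
    ∫⁻ z, min (∫⁻ x in ball z r, f x) ((∫⁻ x in ball z r, f x) ^ 2) ≤
      2 * (volume (ball (0 : E) r) * ∫⁻ x in A, f x) +
        4 * (volume (ball (0 : E) r) ^ 2 * ∫⁻ x in Aᶜ, f x ^ 2) := by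
  set V := volume (ball (0 : E) r)
  have hcauchy : ∀ z, (∫⁻ x in ball z r, f x ∂(volume.restrict Aᶜ)) ^ 2 ≤
      V * ∫⁻ x in ball z r, f x ^ 2 ∂(volume.restrict Aᶜ) := fun z => by
    refine (sq_lintegral_le _ hf.aemeasurable).trans ?_
    gcongr
    rw [Measure.restrict_apply_univ]
    exact (Measure.restrict_apply_le _ _).trans_eq (Measure.addHaar_ball_center volume z r)
  have hmeas : Measurable fun z => ∫⁻ x in ball z r, f x ∂(volume.restrict A) :=
    measurable_setLIntegral_section (S := {q : E × E | dist q.2 q.1 < r})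
      (measurableSet_lt (by fun_prop) (by fun_prop)) hf _
  calc _ ≤ ∫⁻ z, 2 * (∫⁻ x in ball z r, f x ∂(volume.restrict A)) +
          4 * (V * ∫⁻ x in ball z r, f x ^ 2 ∂(volume.restrict Aᶜ)) := by
        refine lintegral_mono fun z => ?_
        rw [← lintegral_add_compl f hA, ← Measure.restrict_comm measurableSet_ball,
          ← Measure.restrict_comm measurableSet_ball]
        exact (min_add_sq_le _ _).trans (by gcongr; exact hcauchy z)
    _ = _ := by
        rw [lintegral_add_left (hmeas.const_mul _), lintegral_const_mul _ hmeas,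
          lintegral_const_mul' _ _ (by simp), lintegral_const_mul' _ _ measure_ball_lt_top.ne,
          lintegral_setLIntegral_ball r _ hf, lintegral_setLIntegral_ball r _ (hf.pow_const 2),
          sq V, mul_assoc V V]

theorem ofReal_rpow_mul_lintegral_min_le (s : ℝ) {r : ℝ} (hr : 0 < r) {f : E → ℝ≥0∞}
    (hf : Measurable f) {A : Set E} (hA : MeasurableSet A) :
    ENNReal.ofReal (r ^ (-s - 1 - finrank ℝ E)) *
        ∫⁻ z, min (∫⁻ x in ball z r, f x) ((∫⁻ x in ball z r, f x) ^ 2) ≤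
      2 * volume (ball (0 : E) 1) * (ENNReal.ofReal (r ^ (-s - 1)) * ∫⁻ x in A, f x) +
        4 * volume (ball (0 : E) 1) ^ 2 *
          (ENNReal.ofReal (r ^ (finrank ℝ E - s - 1)) * ∫⁻ x in Aᶜ, f x ^ 2) := by
  have hlin := ofReal_rpow_mul_volume_ball (-s - 1) hr (0 : E)
  have hquad := ofReal_rpow_mul_volume_ball (finrank ℝ E - s - 1) hr (0 : E)
  rw [show (finrank ℝ E : ℝ) - s - 1 - finrank ℝ E = -s - 1 by ring] at hquad
  refine (mul_le_mul_right (lintegral_min_setLIntegral_ball_le r hf hA) _).trans_eq ?_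
  set w := ENNReal.ofReal (r ^ (-s - 1 - finrank ℝ E))
  set V := volume (ball (0 : E) r)
  set ω := volume (ball (0 : E) 1)
  set F := ∫⁻ x in A, f x
  set G := ∫⁻ x in Aᶜ, f x ^ 2
  calc w * (2 * (V * F) + 4 * (V ^ 2 * G)) = 2 * (w * V) * F + 4 * ((w * V) * V * G) := by ring
    _ = 2 * ω * (ENNReal.ofReal (r ^ (-s - 1)) * F) +
          4 * (ω * (ENNReal.ofReal (r ^ (-s - 1)) * V) * G) := by rw [hlin]; ring
    _ = _ := by rw [hquad]; ring

/-- At radius `r` the density is split at the level `r ^ (-d)`; the part above it is estimated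
through the mass of a ball, the part below it through the square of the mass. -/
theorem lintegral_min_scaleMeasure_le {s : ℝ} (hs : 0 < s) (hsd : s < finrank ℝ E)
    {f : E → ℝ≥0∞} (hf : Measurable f) :
    ∫⁻ p, min (∫⁻ x in ball p.2 p.1, f x) ((∫⁻ x in ball p.2 p.1, f x) ^ 2) ∂(scaleMeasure E s) ≤
      (2 * volume (ball (0 : E) 1) * ENNReal.ofReal (1 / s) +
        4 * volume (ball (0 : E) 1) ^ 2 * ENNReal.ofReal (1 / (finrank ℝ E - s))) *
        ∫⁻ x, f x ^ (1 + s / finrank ℝ E) := by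
  set ω := volume (ball (0 : E) 1)
  set I := ∫⁻ x, f x ^ (1 + s / finrank ℝ E)
  have hS : MeasurableSet {q : ℝ × E | ENNReal.ofReal (q.1 ^ (-(finrank ℝ E : ℝ))) < f q.2} :=
    measurableSet_lt (by fun_prop) (by fun_prop)
  let A : ℝ → Set E := fun r => {x | ENNReal.ofReal (r ^ (-(finrank ℝ E : ℝ))) < f x}
  have hA : ∀ r, MeasurableSet (A r) := fun r => measurableSet_lt measurable_const hf
  have hmass : Measurable fun p : ℝ × E => ∫⁻ x in ball p.2 p.1, f x :=
    measurable_setLIntegral_section (S := {q : (ℝ × E) × E | dist q.2 q.1.2 < q.1.1})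
      (measurableSet_lt (by fun_prop) (by fun_prop)) hf _
  have hhigh : ∫⁻ r in Set.Ioi (0 : ℝ), ENNReal.ofReal (r ^ (-s - 1)) * ∫⁻ x in A r, f x ≤
      ENNReal.ofReal (1 / s) * I := by
    refine (lintegral_mul_setLIntegral_section_swap hS hf _ volume
      (g := fun r => ENNReal.ofReal (r ^ (-s - 1))) (by fun_prop)).trans_le ?_
    rw [← lintegral_const_mul _ (by fun_prop)]
    exact lintegral_mono fun x => mul_setLIntegral_rpow_le hs (hs.trans hsd) (f x)
  have hlow : ∫⁻ r in Set.Ioi (0 : ℝ), ENNReal.ofReal (r ^ (finrank ℝ E - s - 1)) *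
      ∫⁻ x in (A r)ᶜ, f x ^ 2 ≤ ENNReal.ofReal (1 / (finrank ℝ E - s)) * I := by
    refine (lintegral_mul_setLIntegral_section_swap hS.compl (hf.pow_const 2) _ volume
      (g := fun r => ENNReal.ofReal (r ^ (finrank ℝ E - s - 1))) (by fun_prop)).trans_le ?_
    rw [← lintegral_const_mul _ (by fun_prop)]
    exact lintegral_mono fun x => sq_mul_setLIntegral_rpow_le hs hsd (f x)
  have hhigh_meas : Measurable fun r => ENNReal.ofReal (r ^ (-s - 1)) * ∫⁻ x in A r, f x :=
    Measurable.mul (by fun_prop) (measurable_setLIntegral_section hS hf _)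
  have hlow_meas : Measurable fun r : ℝ => ENNReal.ofReal (r ^ (finrank ℝ E - s - 1)) *
      ∫⁻ x in (A r)ᶜ, f x ^ 2 :=
    Measurable.mul (by fun_prop) (measurable_setLIntegral_section hS.compl (hf.pow_const 2) _)
  rw [lintegral_scaleMeasure s (hmass.min (hmass.pow_const 2))]
  calc _ ≤ ∫⁻ r in Set.Ioi (0 : ℝ),
        2 * ω * (ENNReal.ofReal (r ^ (-s - 1)) * ∫⁻ x in A r, f x) +
          4 * ω ^ 2 * (ENNReal.ofReal (r ^ (finrank ℝ E - s - 1)) * ∫⁻ x in (A r)ᶜ, f x ^ 2) :=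
        setLIntegral_mono' measurableSet_Ioi fun r hr =>
          ofReal_rpow_mul_lintegral_min_le s hr hf (hA r)
    _ ≤ 2 * ω * (ENNReal.ofReal (1 / s) * I) +
          4 * ω ^ 2 * (ENNReal.ofReal (1 / (finrank ℝ E - s)) * I) := by
        rw [lintegral_add_left (hhigh_meas.const_mul _), lintegral_const_mul _ hhigh_meas,
          lintegral_const_mul _ hlow_meas]
        gcongr
    _ = _ := by ring

end Fluctuation

section LiebOxford

open Metric Module

theorem exists_norm_eq_one_of_finrank_pos {E : Type*} [NormedAddCommGroup E] [NormedSpace ℝ E]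
    (h : 0 < finrank ℝ E) : ∃ e : E, ‖e‖ = 1 :=
  have : Nontrivial E := nontrivial_of_finrank_pos h
  exists_norm_eq E zero_le_one

variable {E : Type*} [NormedAddCommGroup E] [InnerProductSpace ℝ E] [FiniteDimensional ℝ E]
  [MeasurableSpace E] [BorelSpace E]

/-- A Lieb–Oxford constant for the costs `powerCost s` with `0 < s ≤ d - ε` on a `d`-dimensional
space. -/
noncomputable def liebOxfordConst (E : Type*) [NormedAddCommGroup E] [InnerProductSpace ℝ E]
    [FiniteDimensional ℝ E] [MeasurableSpace E] [BorelSpace E] (ε : ℝ) : ℝ :=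
  2 ^ (finrank ℝ E + 1) * (1 + 2 * volume.real (ball (0 : E) 1) * finrank ℝ E / ε)

theorem liebOxfordConst_pos {ε : ℝ} (hε : 0 < ε) : 0 < liebOxfordConst E ε := by
  unfold liebOxfordConst
  positivity

theorem fluctuation_const_le_mul_ballKernel {s ε : ℝ} (hs : 0 < s) (hε : 0 < ε)
    (hsε : s ≤ finrank ℝ E - ε) {e : E} (he : ‖e‖ = 1) :
    2 * volume (ball (0 : E) 1) * ENNReal.ofReal (1 / s) +
        4 * volume (ball (0 : E) 1) ^ 2 * ENNReal.ofReal (1 / (finrank ℝ E - s)) ≤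
      ENNReal.ofReal (liebOxfordConst E ε) * ballKernel s 0 e := by
  set d := finrank ℝ E with hd
  set v := volume.real (ball (0 : E) 1) with hv
  have hvolume : volume (ball (0 : E) 1) = ENNReal.ofReal v :=
    (ofReal_measureReal measure_ball_lt_top.ne).symm
  have hds : ε ≤ d - s := by linarith
  have hds0 : 0 < d - s := hε.trans_le hds
  have hgap : 1 / (d - s) ≤ d / (ε * s) := by
    rw [div_le_div_iff₀ hds0 (by positivity), one_mul, mul_comm]
    exact mul_le_mul (by linarith) hds hε.le d.cast_nonneg
  have hreal : 2 * v * (1 / s) + 4 * v ^ 2 * (1 / (d - s)) ≤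
      liebOxfordConst E ε * (2⁻¹ ^ d * (1 / s * v)) := by
    calc _ ≤ 2 * v * (1 / s) + 4 * v ^ 2 * (d / (ε * s)) := by gcongr
      _ = _ := by
        rw [liebOxfordConst, ← hd, ← hv, inv_pow]
        field_simp
        ring
  calc _ = ENNReal.ofReal (2 * v * (1 / s) + 4 * v ^ 2 * (1 / (d - s))) := by
        rw [hvolume, ENNReal.ofReal_add (by positivity) (by positivity),
          ENNReal.ofReal_mul (by positivity), ENNReal.ofReal_mul (by positivity),
          ENNReal.ofReal_mul (by positivity), ENNReal.ofReal_mul (by positivity),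
          ENNReal.ofReal_pow measureReal_nonneg, ENNReal.ofReal_ofNat, ENNReal.ofReal_ofNat]
    _ ≤ ENNReal.ofReal (liebOxfordConst E ε * (2⁻¹ ^ d * (1 / s * v))) :=
        ENNReal.ofReal_le_ofReal hreal
    _ = ENNReal.ofReal (liebOxfordConst E ε) *
          (ENNReal.ofReal (2⁻¹ ^ d) * (ENNReal.ofReal (1 / s) * volume (ball (0 : E) 1))) := by
        rw [hvolume, ENNReal.ofReal_mul (liebOxfordConst_pos hε).le,
          ENNReal.ofReal_mul (by positivity), ENNReal.ofReal_mul (by positivity)]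
    _ ≤ _ := by
        gcongr
        exact le_ballKernel_of_norm_eq_one hs he

variable {s ε : ℝ} (hs : 0 < s) (hε : 0 < ε) (hsε : s ≤ finrank ℝ E - ε)
include hs hε hsε

theorem lintegral_min_ballInd_withDensity_le {e : E} (he : ‖e‖ = 1) {f : E → ℝ≥0∞}
    (hf : AEMeasurable f volume) :
    ∫⁻ p, min (∫⁻ x, ballInd p x ∂(volume.withDensity f))
        ((∫⁻ x, ballInd p x ∂(volume.withDensity f)) ^ 2)
        ∂((ballKernel s 0 e)⁻¹ • scaleMeasure E s) ≤
      ENNReal.ofReal (liebOxfordConst E ε) * ∫⁻ x, f x ^ (1 + s / finrank ℝ E) := by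
  wlog hmeas : Measurable f generalizing f
  · have h := this hf.measurable_mk.aemeasurable hf.measurable_mk
    have hpow : ∫⁻ x, f x ^ (1 + s / finrank ℝ E) = ∫⁻ x, hf.mk f x ^ (1 + s / finrank ℝ E) :=
      lintegral_congr_ae (hf.ae_eq_mk.fun_comp (· ^ (1 + s / finrank ℝ E)))
    rwa [← withDensity_congr_ae hf.ae_eq_mk, ← hpow] at h
  simp only [lintegral_ballInd, withDensity_apply _ measurableSet_ball]
  rw [lintegral_smul_measure, smul_eq_mul, ENNReal.inv_mul_le_iff
    (ballKernel_pos_of_norm_eq_one hs he).ne' (ballKernel_lt_top_of_norm_eq_one hs he).ne]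
  refine (lintegral_min_scaleMeasure_le hs (by linarith) hmeas).trans ?_
  rw [← mul_assoc, mul_comm (ballKernel s 0 e)]
  gcongr
  exact fluctuation_const_le_mul_ballKernel hs hε hsε he

theorem meanField_powerCost_withDensity_le {f : E → ℝ≥0∞} (hf : AEMeasurable f volume)
    [IsProbabilityMeasure (volume.withDensity f)] :
    meanField (powerCost s) (volume.withDensity f) ≤
      ENNReal.ofReal (liebOxfordConst E ε) * ∫⁻ x, f x ^ (1 + s / finrank ℝ E) := by
  obtain ⟨e, he⟩ := exists_norm_eq_one_of_finrank_pos
    (Nat.cast_pos.1 (show (0 : ℝ) < finrank ℝ E by linarith))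
  rw [meanField_eq_lintegral_sq measurable_ballInd (powerCost_eq_lintegral_ballInd hs he)]
  refine le_trans (lintegral_mono fun p => le_min ?_ le_rfl)
    (lintegral_min_ballInd_withDensity_le hs hε hsε he hf)
  rw [lintegral_ballInd]
  exact pow_le_of_le_one zero_le prob_le_one two_ne_zero

theorem sq_mul_meanField_powerCost_le_gcCost_add {f : E → ℝ≥0∞} (hf : AEMeasurable f volume)
    [IsProbabilityMeasure (volume.withDensity f)] (N : ℝ) :
    ENNReal.ofReal N ^ 2 * meanField (powerCost s) (volume.withDensity f) ≤
      gcCost (powerCost s) N (volume.withDensity f) +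
        ENNReal.ofReal (liebOxfordConst E ε) *
          (ENNReal.ofReal N ^ (1 + s / finrank ℝ E) * ∫⁻ x, f x ^ (1 + s / finrank ℝ E)) := by
  obtain ⟨e, he⟩ := exists_norm_eq_one_of_finrank_pos
    (Nat.cast_pos.1 (show (0 : ℝ) < finrank ℝ E by linarith))
  have hfluct := lintegral_min_ballInd_withDensity_le hs hε hsε he
    (hf.const_mul (ENNReal.ofReal N))
  have hp : 0 ≤ 1 + s / finrank ℝ E := by positivity
  simp only [ENNReal.mul_rpow_of_nonneg _ _ hp] at hfluct
  rw [lintegral_const_mul' _ _ (ENNReal.rpow_ne_top_of_nonneg hp ENNReal.ofReal_ne_top)] at hfluct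
  have hdensity : volume.withDensity (fun x => ENNReal.ofReal N * f x) =
      ENNReal.ofReal N • volume.withDensity f :=
    withDensity_smul' _ _ ENNReal.ofReal_ne_top
  rw [hdensity] at hfluct
  rw [← meanField_smul _ _ ENNReal.ofReal_ne_top]
  refine (meanField_smul_le_gcCost_add measurable_ballInd (powerCost_eq_lintegral_ballInd hs he)
    ballInd_le_one N _).trans ?_
  gcongr

end LiebOxford

section Bounds

theorem rpow_neg_mul_sub_bounds {F T : ℝ≥0∞} {N p C I : ℝ} (hN : 0 < N) (hT : T ≠ ⊤) (hFT : F ≤ T)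
    (hCI : 0 ≤ C * I) (hTF : T ≤ F + ENNReal.ofReal (C * (N ^ p * I))) :
    ((-C * I : ℝ) : EReal) ≤ ((N ^ (-p) : ℝ) : EReal) * ((F : EReal) - (T : EReal)) ∧
      ((N ^ (-p) : ℝ) : EReal) * ((F : EReal) - (T : EReal)) ≤ 0 := by
  lift F to NNReal using ne_top_of_le_ne_top hT hFT
  lift T to NNReal using hT
  have hNp : 0 < N ^ p := Real.rpow_pos_of_pos hN p
  have hnonneg : 0 ≤ C * (N ^ p * I) := by
    rw [mul_left_comm]
    positivity
  have hle : (F : ℝ) ≤ T := by exact_mod_cast hFT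
  have hge : (T : ℝ) ≤ F + C * (N ^ p * I) := by
    rw [ENNReal.ofReal, ← ENNReal.coe_add, ENNReal.coe_le_coe, ← NNReal.coe_le_coe] at hTF
    rwa [NNReal.coe_add, Real.coe_toNNReal _ hnonneg] at hTF
  have hcoe : ((N ^ (-p) : ℝ) : EReal) * (((F : ℝ≥0∞) : EReal) - ((T : ℝ≥0∞) : EReal)) =
      (((F - T) / N ^ p : ℝ) : EReal) := by
    rw [Real.rpow_neg hN.le, div_eq_inv_mul, EReal.coe_mul, EReal.coe_sub]
    rfl
  rw [hcoe, ← EReal.coe_zero, EReal.coe_le_coe_iff, EReal.coe_le_coe_iff]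
  refine ⟨?_, div_nonpos_of_nonpos_of_nonneg (by linarith) hNp.le⟩
  rw [le_div_iff₀ hNp]
  linarith

theorem lintegral_ofReal_rpow_eq {X : Type*} [MeasurableSpace X] {μ : Measure X} {ρ : X → ℝ}
    {p : ℝ} (hp : 0 < p) (hρ0 : ∀ x, 0 ≤ ρ x) (hρ : MemLp ρ (ENNReal.ofReal p) μ) :
    ∫⁻ x, ENNReal.ofReal (ρ x) ^ p ∂μ = ENNReal.ofReal (∫ x, ρ x ^ p ∂μ) := by
  have hint := hρ.integrable_norm_rpow (by simpa using hp) ENNReal.ofReal_ne_top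
  simp only [ENNReal.toReal_ofReal hp.le, Real.norm_of_nonneg (hρ0 _)] at hint
  rw [ofReal_integral_eq_lintegral_ofReal hint
    (.of_forall fun x => Real.rpow_nonneg (hρ0 x) _)]
  exact lintegral_congr fun x => ENNReal.ofReal_rpow_of_nonneg (hρ0 x) hp.le

end Bounds

end RieszOT

open Module RieszOT in
theorem lemmaC1_general {E : Type*} [NormedAddCommGroup E] [InnerProductSpace ℝ E]
    [FiniteDimensional ℝ E] [MeasurableSpace E] [BorelSpace E] {ε : ℝ} (hε : 0 < ε) :
    ∃ cLO : ℝ, cLO < 0 ∧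
      ∀ s : ℝ, 0 < s → s ≤ finrank ℝ E - ε →
      ∀ (μ : Measure E) [IsProbabilityMeasure μ] (ρ : E → ℝ), (∀ x, 0 ≤ ρ x) →
        MemLp ρ (ENNReal.ofReal (1 + s / finrank ℝ E)) volume →
        μ = volume.withDensity (fun x => ENNReal.ofReal (ρ x)) →
        (∀ N : ℕ, 0 < N →
          ((cLO * ∫ x, ρ x ^ (1 + s / finrank ℝ E) : ℝ) : EReal) ≤
              (((N : ℝ) ^ (-1 - s / finrank ℝ E) : ℝ) : EReal) * exc (powerCost s) N μ ∧
            (((N : ℝ) ^ (-1 - s / finrank ℝ E) : ℝ) : EReal) * exc (powerCost s) N μ ≤ 0) ∧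
        (∀ N : ℝ, 0 < N →
          ((cLO * ∫ x, ρ x ^ (1 + s / finrank ℝ E) : ℝ) : EReal) ≤
              ((N ^ (-1 - s / finrank ℝ E) : ℝ) : EReal) * gcExc (powerCost s) N μ ∧
            ((N ^ (-1 - s / finrank ℝ E) : ℝ) : EReal) * gcExc (powerCost s) N μ ≤ 0) := by
  refine ⟨-liebOxfordConst E ε, neg_neg_of_pos (liebOxfordConst_pos hε), ?_⟩
  rintro s hs hsε μ hprob ρ hρ0 hρ rfl
  set C := liebOxfordConst E ε
  set p := 1 + s / finrank ℝ E
  set μ := volume.withDensity fun x => ENNReal.ofReal (ρ x)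
  have hp : 0 < p := by positivity
  have hC : 0 ≤ C := (liebOxfordConst_pos hε).le
  have hc := measurable_uncurry_powerCost (X := E) s
  have hf : AEMeasurable (fun x => ENNReal.ofReal (ρ x)) := hρ.1.aemeasurable.ennreal_ofReal
  have hI : ∫⁻ x, ENNReal.ofReal (ρ x) ^ p = ENNReal.ofReal (∫ x, ρ x ^ p) :=
    lintegral_ofReal_rpow_eq hp hρ0 hρ
  have hCI : 0 ≤ C * ∫ x, ρ x ^ p :=
    mul_nonneg hC (integral_nonneg fun x => Real.rpow_nonneg (hρ0 x) _)
  have hfinite : meanField (powerCost s) μ ≠ ⊤ :=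
    ne_top_of_le_ne_top (by rw [hI]; finiteness) (meanField_powerCost_withDensity_le hs hε hsε hf)
  have hlower : ∀ N : ℝ, 0 < N → ENNReal.ofReal N ^ 2 * meanField (powerCost s) μ ≤
      gcCost (powerCost s) N μ + ENNReal.ofReal (C * (N ^ p * ∫ x, ρ x ^ p)) := fun N hN => by
    rw [ENNReal.ofReal_mul hC, ENNReal.ofReal_mul (by positivity),
      ← ENNReal.ofReal_rpow_of_pos hN, ← hI]
    exact sq_mul_meanField_powerCost_le_gcCost_add hs hε hsε hf N
  rw [show -1 - s / finrank ℝ E = -p by ring]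
  refine ⟨fun N hN => ?_, fun N hN => rpow_neg_mul_sub_bounds hN (by finiteness)
    (gcCost_le_sq_mul_meanField hc N μ) hCI (hlower N hN)⟩
  have hN' : (0 : ℝ) < N := Nat.cast_pos.2 hN
  refine rpow_neg_mul_sub_bounds hN' (by finiteness) (otCost_le_sq_mul_meanField hc N μ) hCI ?_
  rw [← ENNReal.ofReal_natCast]
  exact (hlower N hN').trans (by gcongr; exact gcCost_le_otCost _ N μ)

theorem lemmaC1 (d : ℕ) (ε : ℝ) (hε : 0 < ε) (hεd : ε < (d : ℝ) / 2) :
    ∃ cLO : ℝ, cLO < 0 ∧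
      ∀ s : ℝ, ε ≤ s → s ≤ (d : ℝ) - ε →
      ∀ (μ : Measure (EuclideanSpace ℝ (Fin d))) [IsProbabilityMeasure μ]
        (ρ : EuclideanSpace ℝ (Fin d) → ℝ), (∀ x, 0 ≤ ρ x) →
        MemLp ρ (ENNReal.ofReal (1 + s / d)) volume →
        μ = volume.withDensity (fun x => ENNReal.ofReal (ρ x)) →
        (∀ N : ℕ, 2 ≤ N →
          ((cLO * ∫ x, ρ x ^ (1 + s / d) : ℝ) : EReal) ≤
              (((N : ℝ) ^ (-1 - s / d) : ℝ) : EReal) *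
                RieszOT.exc (RieszOT.rieszCost d s) N μ ∧
            (((N : ℝ) ^ (-1 - s / d) : ℝ) : EReal) *
                RieszOT.exc (RieszOT.rieszCost d s) N μ ≤ 0) ∧
        (∀ N : ℝ, 2 ≤ N →
          ((cLO * ∫ x, ρ x ^ (1 + s / d) : ℝ) : EReal) ≤
              ((N ^ (-1 - s / d) : ℝ) : EReal) *
                RieszOT.gcExc (RieszOT.rieszCost d s) N μ ∧
            ((N ^ (-1 - s / d) : ℝ) : EReal) *
                RieszOT.gcExc (RieszOT.rieszCost d s) N μ ≤ 0) := by
  obtain ⟨c, hc, h⟩ := lemmaC1_general (E := EuclideanSpace ℝ (Fin d)) hε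
  rw [finrank_euclideanSpace_fin] at h
  refine ⟨c, hc, fun s hs hsd μ _ ρ hρ0 hρ hμ => ?_⟩
  obtain ⟨hcan, hgc⟩ := h s (hε.trans_le hs) hsd μ ρ hρ0 hρ hμ
  exact ⟨fun N hN => hcan N (by lia), fun N hN => hgc N (by linarith)⟩
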